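/- Let $\lambda>-\frac12$, let $(x)_0=1$, $(x)_n=\prod_{k=1}^n(x+k-1)$ be the Pochhammer symbol, let $B$ be the beta function, and let $w(x)=B(\frac12,\lambda+\frac12)^{-1}(1-x^2)^{\lambda-\frac12}$ on $(-1,1)$ be the normalized Gegenbauer weight. For $l\ge 1$ let $\{\varphi^\lambda_n(\cdot,l)\}_{n\ge0}$ be the orthonormal polynomials for the weight $x^{2l}w(x)$ on $(-1,1)$, that is, the (existing and unique) family of real polynomials with $\deg\varphi^\lambda_n(\cdot,l)=n$, with positive leading coefficient $k^{\lambda,l}_n$, and with $\int_{-1}^1\varphi^\lambda_m(x,l)\varphi^\lambda_n(x,l)\,x^{2l}w(x)\,dx=\delta_{m,n}$. Let $P^{(\alpha,\beta)}_n(x)=\frac{(-1)^n}{2^nn!}(1-x)^{-\alpha}(1+x)^{-\beta}\frac{d^n}{dx^n}\left[(1-x)^{\alpha+n}(1+x)^{\beta+n}\right]$ be the Jacobi polynomials, and let $$C^{(\lambda,l)}_{2n}(x)=\frac{(\lambda+l)_n}{(l+\frac12)_n}P_n^{(\lambda-\frac12,\,l-\frac12)}(2x^2-1),\qquad C^{(\lambda,l)}_{2n+1}(x)=\frac{(\lambda+l)_{n+1}}{(l+\frac12)_{n+1}}\,x\,P_n^{(\lambda-\frac12,\,l+\frac12)}(2x^2-1)$$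 be the modified Gegenbauer polynomials, with norms $$h^{\lambda,l}_m=\frac1{B(l+\frac12,\lambda+\frac12)}\int_{-1}^1\left(C^{(\lambda,l)}_m(x)\right)^2x^{2l}(1-x^2)^{\lambda-\frac12}\,dx .$$ Then for all $n,l\ge1$ $$\varphi^\lambda_{2n}(0,l)=(-1)^n\sqrt{\frac{(\lambda+1)_l}{(\frac12)_l\,h^{\lambda,l}_{2n}}}\;\prod_{k=1}^n\frac{\lambda+l+k-1}{k},$$ $$k^{\lambda,l}_{2n}=\frac{(\lambda+l)_{2n}}{(l+\frac12)_n\,n!}\sqrt{\frac{(\lambda+1)_l}{(\frac12)_l\,h^{\lambda,l}_{2n}}},\qquad k^{\lambda,l}_{2n+1}=\frac{(\lambda+l)_{2n+1}}{(l+\frac12)_{n+1}\,n!}\sqrt{\frac{(\lambda+1)_l}{(\frac12)_l\,h^{\lambda,l}_{2n+1}}},$$ and $$h^{\lambda,l}_{2n}=\frac{(\lambda+\frac12)_n(\lambda+l)_n(\lambda+l)}{n!\,(l+\frac12)_n(\lambda+l+2n)},\qquad h^{\lambda,l}_{2n+1}=\frac{(\lambda+\frac12)_n(\lambda+l)_{n+1}(\lambda+l)}{n!\,(l+\frac12)_{n+1}(\lambda+l+2n+1)}.$$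 -/

import Mathlib

open Polynomial

/-- The Pochhammer symbol `(x)_n = x (x + 1) ⋯ (x + n - 1)`, with `(x)_0 = 1`. -/
noncomputable abbrev poch (x : ℝ) (n : ℕ) : ℝ := (ascPochhammer ℝ n).eval x

/-- The normalized Gegenbauer weight `B(1/2, lam + 1/2)⁻¹ (1 - x²)^(lam - 1/2)` on `(-1, 1)`. -/
noncomputable def gegenbauerWeight (lam : ℝ) (x : ℝ) : ℝ :=
  (ProbabilityTheory.beta (1 / 2) (lam + 1 / 2))⁻¹ * (1 - x ^ 2) ^ (lam - 1 / 2)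

/-- `φ 0, φ 1, …` are the orthonormal polynomials for the weight `w` on `(-1, 1)`: `φ n` has exact
degree `n`, its leading coefficient is positive, and the family is orthonormal. -/
structure IsOrthonormalPolynomials (w : ℝ → ℝ) (φ : ℕ → ℝ[X]) : Prop where
  natDegree_eq : ∀ n, (φ n).natDegree = n
  leadingCoeff_pos : ∀ n, 0 < (φ n).leadingCoeff
  orthonormal : ∀ m n,
    ∫ x in (-1 : ℝ)..1, (φ m).eval x * (φ n).eval x * w x = if m = n then 1 else 0

/-- The Jacobi polynomial `P_n^{(α, β)}`, in the form
`∑ i ≤ n, binom(n + α, i) binom(n + β, n - i) ((x - 1) / 2)^(n - i) ((x + 1) / 2)^i`,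
where `binom(n + α, i) = (α + n - i + 1)_i / i!` and
`binom(n + β, n - i) = (β + i + 1)_{n - i} / (n - i)!`.
That it satisfies the Rodrigues formula is `jacobi_rodrigues` below. -/
noncomputable def jacobi (α β : ℝ) (n : ℕ) : ℝ[X] :=
  ∑ i ∈ Finset.range (n + 1),
    C (poch (α + n - i + 1) i / (i.factorial : ℝ)
        * (poch (β + i + 1) (n - i) / ((n - i).factorial : ℝ)))
      * (C (1 / 2) * (X - 1)) ^ (n - i) * (C (1 / 2) * (X + 1)) ^ i

/-- The modified Gegenbauer polynomials `C_m^{(lam, l)}`: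
`C_{2n}(x) = (lam + l)_n / (l + 1/2)_n * P_n^{(lam - 1/2, l - 1/2)}(2 x² - 1)` and
`C_{2n+1}(x) = (lam + l)_{n+1} / (l + 1/2)_{n+1} * x * P_n^{(lam - 1/2, l + 1/2)}(2 x² - 1)`. -/
noncomputable def modifiedGegenbauer (lam : ℝ) (l m : ℕ) : ℝ[X] :=
  if Even m then
    C (poch (lam + l) (m / 2) / poch (l + 1 / 2) (m / 2))
      * (jacobi (lam - 1 / 2) (l - 1 / 2) (m / 2)).comp (2 * X ^ 2 - 1)
  else
    C (poch (lam + l) (m / 2 + 1) / poch (l + 1 / 2) (m / 2 + 1))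
      * X * (jacobi (lam - 1 / 2) (l + 1 / 2) (m / 2)).comp (2 * X ^ 2 - 1)

/-- The norm `h_m^{lam, l}`: the integral of the square of `C_m^{(lam, l)}` against the probability
density `B(l + 1/2, lam + 1/2)⁻¹ x^(2l) (1 - x²)^(lam - 1/2)` on `(-1, 1)`. -/
noncomputable def modifiedGegenbauerNorm (lam : ℝ) (l m : ℕ) : ℝ :=
  (ProbabilityTheory.beta (l + 1 / 2) (lam + 1 / 2))⁻¹
    * ∫ x in (-1 : ℝ)..1,
        ((modifiedGegenbauer lam l m).eval x) ^ 2 * (x ^ (2 * l) * (1 - x ^ 2) ^ (lam - 1 / 2))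

/-- Rodrigues' formula for the Jacobi polynomials. -/
theorem jacobi_rodrigues (α β : ℝ) (n : ℕ) (x : ℝ) (hx : x ∈ Set.Ioo (-1 : ℝ) 1) :
    (jacobi α β n).eval x =
      (-1) ^ n / (2 ^ n * (n.factorial : ℝ)) * (1 - x) ^ (-α) * (1 + x) ^ (-β)
        * iteratedDeriv n (fun y : ℝ => (1 - y) ^ (α + n) * (1 + y) ^ (β + n)) x := by
  obtain ⟨h1, h2⟩ := hx
  have ha : 0 < 1 - x := by linarith
  have hb : 0 < 1 + x := by linarith
  have hf : ContDiffAt ℝ n (fun y : ℝ => (1 - y) ^ (α + n)) x :=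
    (contDiffAt_const.sub contDiffAt_id).rpow_const_of_ne ha.ne'
  have hg : ContDiffAt ℝ n (fun y : ℝ => (1 + y) ^ (β + n)) x :=
    (contDiffAt_const.add contDiffAt_id).rpow_const_of_ne hb.ne'
  have hmul := iteratedDeriv_mul hf hg
  have e (r y : ℝ) (k : ℕ) :
      iteratedDeriv k (fun z : ℝ => z ^ r) y = poch (r - k + 1) k * y ^ (r - k) := by
    rw [iteratedDeriv_eq_iterate, Real.iter_deriv_rpow_const,
      descPochhammer_eval_eq_ascPochhammer]
  have e1 : ∀ k, iteratedDeriv k (fun y : ℝ => (1 - y) ^ (α + n)) x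
      = (-1) ^ k * (poch (α + n - k + 1) k * (1 - x) ^ (α + n - k)) := by
    intro k
    have := congrFun (iteratedDeriv_comp_const_sub k (fun y : ℝ => y ^ (α + n)) 1) x
    rw [this]
    simp only [smul_eq_mul]
    rw [e]
  have e2 : ∀ k, iteratedDeriv k (fun y : ℝ => (1 + y) ^ (β + n)) x
      = poch (β + n - k + 1) k * (1 + x) ^ (β + n - k) := by
    intro k
    have := congrFun (iteratedDeriv_comp_const_add k (fun y : ℝ => y ^ (β + n)) 1) x
    rw [this, e]
  have e0 : iteratedDeriv n (fun y : ℝ => (1 - y) ^ (α + n) * (1 + y) ^ (β + n)) x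
      = iteratedDeriv n ((fun y : ℝ => (1 - y) ^ (α + n)) * fun y : ℝ => (1 + y) ^ (β + n)) x :=
    rfl
  rw [e0, hmul, jacobi, eval_finsetSum, Finset.mul_sum]
  refine Finset.sum_congr rfl fun i hi => ?_
  have hin : i ≤ n := Nat.lt_succ_iff.mp (Finset.mem_range.mp hi)
  obtain ⟨j, rfl⟩ := Nat.exists_eq_add_of_le hin
  rw [e1, e2]
  have hsub : i + j - i = j := by omega
  have r1 : (1 - x) ^ (α + ((i + j : ℕ) : ℝ) - i) = (1 - x) ^ α * (1 - x) ^ j := by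
    rw [← Real.rpow_natCast, ← Real.rpow_add ha]; congr 1; push_cast; ring
  have r2 : (1 + x) ^ (β + ((i + j : ℕ) : ℝ) - (j : ℕ)) = (1 + x) ^ β * (1 + x) ^ i := by
    rw [← Real.rpow_natCast, ← Real.rpow_add hb]; congr 1; push_cast; ring
  have r3 : β + ((i + j : ℕ) : ℝ) - (j : ℕ) + 1 = β + i + 1 := by push_cast; ring
  have hc : (((i + j).choose i : ℕ) : ℝ) = ((i + j).factorial : ℝ) / (i.factorial * j.factorial) := by
    rw [Nat.cast_choose ℝ (Nat.le_add_right i j), hsub]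
  rw [hsub, r1, r2, r3, hc, Real.rpow_neg ha.le, Real.rpow_neg hb.le]
  have p1 : (1 - x) ^ α ≠ 0 := (Real.rpow_pos_of_pos ha α).ne'
  have p2 : (1 + x) ^ β ≠ 0 := (Real.rpow_pos_of_pos hb β).ne'
  have f1 : ((i + j).factorial : ℝ) ≠ 0 := by positivity
  simp only [eval_mul, eval_C, eval_pow, eval_sub, eval_add, eval_X, eval_one]
  have s1 : (x - 1) ^ j = (-1) ^ j * (1 - x) ^ j := by rw [← mul_pow]; ring
  have s3 : ∀ m : ℕ, (1 / 2 : ℝ) ^ m = (2 ^ m)⁻¹ := fun m => by rw [one_div, inv_pow]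
  have s2 : ((-1 : ℝ) ^ i) ^ 2 = 1 := by rw [← pow_mul, mul_comm, pow_mul]; simp
  rw [mul_pow, mul_pow, s1, pow_add, pow_add, s3, s3]
  field_simp
  rw [s2]
  ring

/-!
The weight is even, so everything reduces to moments of `x ^ (2 i) (1 - x²) ^ (j + lam - 1/2)`, which
are beta functions by the substitution `t = x²` (`integral_even_pow_mul_pow_mul_weight`). Expanding
the Jacobi polynomial `P_n^{(α, β)}(2 x² - 1)` in the products `x ^ (2 i) (x² - 1) ^ (n - i)` and
integrating against `x ^ (2 k)` term by term, all Gamma factors but one combine into a constant that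
is independent of `i`, and what is left is `∑ i, (-1)^(n - i) binom(n, i) (β + 1 + i)_k`: the `n`-th
forward difference of a monic polynomial of degree `k`, hence `0` for `k < n` and `n!` for `k = n`
(`gegenbauerFunctional_even_pow_mul_jacobi`). Together with parity, this says that `C_m` is
orthogonal to all polynomials of degree less than `m`, and it evaluates the integral of
`C_m x^m`. The odd case is the even one with `l + 1` in place of `l`.

The leading coefficient of the Jacobi polynomial is an instance of the Chu-Vandermonde identity
(`sum_jacobi_coeff`). The squared norm of `C_m` is its leading coefficient times the integral of
`C_m x^m`, which gives the formulas for `h_m` (`modifiedGegenbauerNorm_even`,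
`modifiedGegenbauerNorm_odd`). In particular `h_m > 0`, so that the `C_m` can be normalized. The
result is an orthonormal family, and it is the only one: for any positive definite functional the
orthonormal polynomials are determined by their degrees and the signs of their leading coefficients
(`IsOrthonormalFor.eq_of_orthogonal`). The values and leading coefficients of `φ_m` are therefore
those of `C_m`, rescaled.
-/

/-! ### Pochhammer symbols and the Gamma function -/

@[simp]
theorem poch_zero (x : ℝ) : poch x 0 = 1 := by
  rw [poch, ascPochhammer_zero, eval_one]

theorem poch_succ (x : ℝ) (n : ℕ) : poch x (n + 1) = poch x n * (x + n) :=
  ascPochhammer_succ_eval n x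

theorem poch_pos {x : ℝ} (hx : 0 < x) (n : ℕ) : 0 < poch x n :=
  ascPochhammer_pos n x hx

theorem poch_add (x : ℝ) (m n : ℕ) : poch x (m + n) = poch x m * poch (x + m) n := by
  induction n with
  | zero => simp
  | succ n ih =>
    rw [← add_assoc, poch_succ, poch_succ, ih]
    push_cast
    ring

theorem poch_succ_left (x : ℝ) (n : ℕ) : poch x (n + 1) = x * poch (x + 1) n := by
  have h1 : poch x 1 = x := by rw [poch_succ, poch_zero]; simp
  rw [add_comm, poch_add, h1, Nat.cast_one]

theorem prod_Icc_div_eq_poch (x : ℝ) (n : ℕ) :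
    ∏ k ∈ Finset.Icc 1 n, (x + k - 1) / k = poch x n / (n.factorial : ℝ) := by
  induction n with
  | zero => simp
  | succ n ih =>
    rw [Finset.prod_Icc_succ_top (by omega), ih, poch_succ, Nat.factorial_succ]
    push_cast
    field_simp
    ring

/-- `Γ(x + n) = (x)_n Γ(x)`. -/
theorem gamma_add_nat {x : ℝ} (hx : 0 < x) (n : ℕ) :
    Real.Gamma (x + n) = poch x n * Real.Gamma x := by
  induction n with
  | zero => simp
  | succ n ih =>
    have h : x + (n + 1 : ℕ) = x + n + 1 := by push_cast; ring
    rw [h, Real.Gamma_add_one (by positivity), ih, poch_succ]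
    ring

/-! ### Orthonormal polynomials for a linear functional -/

/-- One step of polynomial division by a family with one member in each degree: subtracting a
multiple of the member of degree `n` cancels the coefficient of `X ^ n`. -/
theorem degree_sub_C_mul_lt {p q : ℝ[X]} {n : ℕ} (hq : q.natDegree = n) (hq0 : 0 < q.leadingCoeff)
    (hp : p.degree < (n + 1 : ℕ)) :
    (p - C (p.coeff n / q.leadingCoeff) * q).degree < n := by
  rw [degree_lt_iff_coeff_zero] at hp ⊢
  intro m hm
  rw [coeff_sub, coeff_C_mul]
  obtain rfl | hlt := hm.eq_or_lt
  · have : q.coeff n = q.leadingCoeff := by rw [leadingCoeff, hq]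
    rw [this, div_mul_cancel₀ _ hq0.ne', sub_self]
  · rw [hp m hlt, coeff_eq_zero_of_natDegree_lt (p := q) (hq ▸ hlt), mul_zero, sub_zero]

theorem linearMap_apply_C_mul (L : ℝ[X] →ₗ[ℝ] ℝ) (a : ℝ) (p : ℝ[X]) : L (C a * p) = a * L p := by
  rw [← smul_eq_C_mul, map_smul, smul_eq_mul]

/-- `φ 0, φ 1, …` are the orthonormal polynomials for the linear functional `L`, in the sense of the
bilinear form `(p, q) ↦ L (p * q)`: `φ n` has exact degree `n` and positive leading coefficient.
No positivity of `L` is assumed; it follows from the existence of `φ`. -/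
structure IsOrthonormalFor (L : ℝ[X] →ₗ[ℝ] ℝ) (φ : ℕ → ℝ[X]) : Prop where
  natDegree_eq : ∀ n, (φ n).natDegree = n
  leadingCoeff_pos : ∀ n, 0 < (φ n).leadingCoeff
  orthonormal : ∀ m n, L (φ m * φ n) = if m = n then 1 else 0

namespace IsOrthonormalFor

variable {L : ℝ[X] →ₗ[ℝ] ℝ} {φ : ℕ → ℝ[X]}

/-- `φ m` is orthogonal to every polynomial of degree less than `m`. The bound `N ≤ m` on the degree
is what the induction runs over. -/
theorem apply_mul_eq_zero (h : IsOrthonormalFor L φ) {m : ℕ} (N : ℕ) (hN : N ≤ m) (q : ℝ[X])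
    (hq : q.degree < N) : L (q * φ m) = 0 := by
  induction N generalizing q with
  | zero =>
    have : q = 0 := by
      rw [← degree_eq_bot]
      simpa using hq
    simp [this]
  | succ N ih =>
    have h1 := ih (by omega) _
      (degree_sub_C_mul_lt (h.natDegree_eq N) (h.leadingCoeff_pos N) hq)
    rw [sub_mul, map_sub, mul_assoc, linearMap_apply_C_mul, h.orthonormal, if_neg (by omega)] at h1
    linarith

/-- A polynomial of degree less than `N` that is orthogonal to `φ j` for all `j < N` is zero: its
top coefficient is detected by the pairing with `φ (N - 1)`. -/
theorem eq_zero_of_forall (h : IsOrthonormalFor L φ) (N : ℕ) (p : ℝ[X]) (hp : p.degree < N)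
    (hL : ∀ j < N, L (p * φ j) = 0) : p = 0 := by
  induction N with
  | zero =>
    rw [← degree_eq_bot]
    simpa using hp
  | succ N ih =>
    have h1 := degree_sub_C_mul_lt (h.natDegree_eq N) (h.leadingCoeff_pos N) hp
    have h2 := h.apply_mul_eq_zero N le_rfl _ h1
    rw [sub_mul, map_sub, mul_assoc, linearMap_apply_C_mul, h.orthonormal, if_pos rfl,
      hL N (by omega)] at h2
    have h3 : p.coeff N / (φ N).leadingCoeff = 0 := by linarith
    rw [h3] at h1
    exact ih (by simpa using h1) fun j hj => hL j (by omega)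

/-- Uniqueness of the orthonormal polynomial of degree `n`: it is determined by its degree, the sign
of its leading coefficient, its norm, and orthogonality to all polynomials of lower degree. -/
theorem eq_of_orthogonal (h : IsOrthonormalFor L φ) {n : ℕ} {ψ : ℝ[X]} (hdeg : ψ.natDegree = n)
    (hpos : 0 < ψ.leadingCoeff) (hnorm : L (ψ * ψ) = 1)
    (horth : ∀ q : ℝ[X], q.degree < n → L (ψ * q) = 0) : φ n = ψ := by
  have hψ : ψ.degree < (n + 1 : ℕ) := by
    refine degree_le_natDegree.trans_lt ?_
    rw [hdeg]
    exact_mod_cast Nat.lt_succ_self n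
  have h1 := degree_sub_C_mul_lt (h.natDegree_eq n) (h.leadingCoeff_pos n) hψ
  have hc : ψ.coeff n = ψ.leadingCoeff := by rw [leadingCoeff, hdeg]
  rw [hc] at h1
  have hcpos : 0 < ψ.leadingCoeff / (φ n).leadingCoeff := div_pos hpos (h.leadingCoeff_pos n)
  set c := ψ.leadingCoeff / (φ n).leadingCoeff
  have h2 : ψ - C c * φ n = 0 := by
    refine h.eq_zero_of_forall n _ h1 fun j hj => ?_
    rw [sub_mul, map_sub, mul_assoc, linearMap_apply_C_mul, h.orthonormal, if_neg (by omega), horth]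
    · simp
    · refine degree_le_natDegree.trans_lt ?_
      rw [h.natDegree_eq]
      exact_mod_cast hj
  -- Comparing norms in `ψ = c φ_n` gives `c² = 1`, and `c` is positive.
  have h3 : ψ = C c * φ n := sub_eq_zero.mp h2
  have h4 : L (ψ * ψ) = c * (c * 1) := by
    have e : C c * φ n * (C c * φ n) = C c * (C c * (φ n * φ n)) := by ring
    rw [h3, e, linearMap_apply_C_mul, linearMap_apply_C_mul, h.orthonormal, if_pos rfl]
  have h5 : c = 1 := by
    rw [hnorm] at h4
    nlinarith
  rw [h3, h5, C_1, one_mul]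

end IsOrthonormalFor

/-! ### Jacobi polynomials -/

theorem ringChoose_eq_poch (r : ℝ) (n : ℕ) :
    Ring.choose r n = poch (r - n + 1) n / (n.factorial : ℝ) := by
  have h : (descPochhammer ℤ n).smeval r = (descPochhammer ℝ n).eval r := by
    rw [← descPochhammer_map (Int.castRingHom ℝ), eval_map, ← eval₂_smulOneHom_eq_smeval]
    congr 1
    exact Subsingleton.elim _ _
  rw [Ring.choose_eq_smul, h, descPochhammer_eval_eq_ascPochhammer, smul_eq_mul, div_eq_inv_mul]

/-- The Chu-Vandermonde identity
`∑ i, binom(n + α, i) binom(n + β, n - i) = binom(2n + α + β, n)`, in Pochhammer symbols. -/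
theorem sum_jacobi_coeff (α β : ℝ) (n : ℕ) :
    ∑ i ∈ Finset.range (n + 1), poch (α + n - i + 1) i / (i.factorial : ℝ)
        * (poch (β + i + 1) (n - i) / ((n - i).factorial : ℝ))
      = poch (α + β + n + 1) n / (n.factorial : ℝ) := by
  have h := Ring.add_choose_eq (r := α + n) (s := β + n) n (Commute.all _ _)
  rw [Finset.Nat.sum_antidiagonal_eq_sum_range_succ_mk, ringChoose_eq_poch] at h
  have e : α + n + (β + n) - n + 1 = α + β + n + 1 := by ring
  rw [e] at h
  rw [h]
  refine Finset.sum_congr rfl fun i hi => ?_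
  have hi' : i ≤ n := Nat.lt_succ_iff.mp (Finset.mem_range.mp hi)
  rw [ringChoose_eq_poch, ringChoose_eq_poch, Nat.cast_sub hi']
  congr 4
  ring

theorem jacobi_natDegree_le (α β : ℝ) (n : ℕ) : (jacobi α β n).natDegree ≤ n := by
  refine natDegree_sum_le_of_forall_le _ _ fun i hi => ?_
  have hi' : i ≤ n := Nat.lt_succ_iff.mp (Finset.mem_range.mp hi)
  have h1 : (C (1 / 2 : ℝ) * (X - 1)).natDegree ≤ 1 := by compute_degree
  have h2 : (C (1 / 2 : ℝ) * (X + 1)).natDegree ≤ 1 := by compute_degree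
  have := natDegree_pow_le_of_le (n - i) h1
  have := natDegree_pow_le_of_le i h2
  refine natDegree_mul_le_of_le (m := n - i) (n := i) ?_ (by omega) |>.trans (by omega)
  exact (natDegree_C_mul_le _ _).trans (by omega)

/-- The coefficient of degree `n`; each term of the defining sum contributes its scalar factor times
`2⁻ⁿ`. -/
theorem jacobi_coeff (α β : ℝ) (n : ℕ) :
    (jacobi α β n).coeff n = poch (α + β + n + 1) n / (n.factorial : ℝ) / 2 ^ n := by
  rw [← sum_jacobi_coeff, jacobi, finsetSum_coeff, Finset.sum_div]
  refine Finset.sum_congr rfl fun i hi => ?_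
  have hi' : i ≤ n := Nat.lt_succ_iff.mp (Finset.mem_range.mp hi)
  have h1 : (C (1 / 2 : ℝ) * (X - 1)).natDegree ≤ 1 := by compute_degree
  have h2 : (C (1 / 2 : ℝ) * (X + 1)).natDegree ≤ 1 := by compute_degree
  have h3 : (C (1 / 2 : ℝ) * (X - 1)).coeff 1 = 1 / 2 := by simp [coeff_one]
  have h4 : (C (1 / 2 : ℝ) * (X + 1)).coeff 1 = 1 / 2 := by simp [coeff_one]
  have h5 := coeff_pow_of_natDegree_le (m := n - i) h1
  have h6 := coeff_pow_of_natDegree_le (m := i) h2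
  rw [mul_one] at h5 h6
  have h7 := natDegree_pow_le_of_le (n - i) h1
  have h8 := natDegree_pow_le_of_le i h2
  rw [mul_one] at h7 h8
  have hn : n = (n - i) + i := by omega
  rw [mul_assoc, coeff_C_mul]
  conv_lhs => rw [hn]
  rw [show n - i + i - i = n - i by omega, ← hn]
  conv_lhs => enter [2, 2]; rw [hn]
  rw [coeff_mul_add_eq_of_natDegree_le h7 h8, h5, h6, h3, h4, ← pow_add, ← hn]
  rw [one_div_pow]
  ring

theorem jacobi_eval_neg_one (α β : ℝ) (n : ℕ) :
    (jacobi α β n).eval (-1) = (-1) ^ n * (poch (β + 1) n / (n.factorial : ℝ)) := by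
  rw [jacobi, eval_finsetSum, Finset.sum_eq_single 0]
  · rw [show (α + n - (0 : ℕ) + 1) = α + n + 1 by simp, poch_zero]
    simp [mul_comm]
    norm_num
  · intro i _ hi
    simp [hi]
  · simp

/-- The `n`-th forward difference of the rising factorial `x ↦ (x)_k`, at `x = b`. -/
theorem sum_neg_one_pow_mul_choose_mul_poch (b : ℝ) (n k : ℕ) (hk : k ≤ n) :
    ∑ i ∈ Finset.range (n + 1), (-1 : ℝ) ^ (n - i) * n.choose i * poch (b + i) k
      = if k = n then (n.factorial : ℝ) else 0 := by
  have h := fwdDiff_iter_eq_sum_shift (1 : ℝ) (ascPochhammer ℝ k).eval n b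
  have e : ∑ i ∈ Finset.range (n + 1), (-1 : ℝ) ^ (n - i) * n.choose i * poch (b + i) k
      = (fwdDiff (1 : ℝ))^[n] (ascPochhammer ℝ k).eval b := by
    rw [h]
    refine Finset.sum_congr rfl fun i _ => ?_
    simp [zsmul_eq_mul]
  rw [e]
  have hd : (ascPochhammer ℝ k).natDegree = k := ascPochhammer_natDegree ℝ k
  split_ifs with hkn
  · subst hkn
    have := (ascPochhammer ℝ k).fwdDiff_iter_degree_eq_factorial
    rw [hd, (monic_ascPochhammer ℝ k).leadingCoeff] at this
    rw [this]
    simp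
  · rw [Polynomial.fwdDiff_iter_eq_zero_of_degree_lt (by omega)]
    rfl

/-! ### Moments of the Gegenbauer weight -/

theorem intervalIntegrable_weight {s : ℝ} (hs : -1 < s) :
    IntervalIntegrable (fun x : ℝ => (1 - x ^ 2) ^ s) MeasureTheory.volume (-1) 1 := by
  have h01 : IntervalIntegrable (fun x : ℝ => (1 - x ^ 2) ^ s) MeasureTheory.volume 0 1 := by
    have h1 : IntervalIntegrable (fun x : ℝ => (1 - x) ^ s) MeasureTheory.volume 0 1 := by
      have := (intervalIntegral.intervalIntegrable_rpow' (a := 1) (b := 0) hs).comp_sub_left 1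
      simpa using this
    have h2 : ContinuousOn (fun x : ℝ => (1 + x) ^ s) (Set.uIcc 0 1) := by
      rw [Set.uIcc_of_le zero_le_one]
      exact ContinuousOn.rpow_const (by fun_prop) fun x hx => Or.inl (by linarith [hx.1])
    refine (h1.mul_continuousOn h2).congr fun x hx => ?_
    rw [Set.uIoc_of_le zero_le_one] at hx
    rw [← Real.mul_rpow (by linarith [hx.2]) (by linarith [hx.1])]
    ring_nf
  have h10 : IntervalIntegrable (fun x : ℝ => (1 - x ^ 2) ^ s) MeasureTheory.volume (-1) 0 := by
    have := (IntervalIntegrable.iff_comp_neg (by finiteness)).1 h01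
    simpa using this.symm
  exact h10.trans h01

theorem intervalIntegrable_eval_mul {s : ℝ} (hs : -1 < s) (p : ℝ[X]) :
    IntervalIntegrable (fun x : ℝ => p.eval x * (1 - x ^ 2) ^ s) MeasureTheory.volume (-1) 1 :=
  (intervalIntegrable_weight hs).continuousOn_mul p.continuous.continuousOn

/-- Euler's beta integral over the reals. -/
theorem setIntegral_beta {a b : ℝ} (ha : 0 < a) (hb : 0 < b) :
    ∫ t in Set.Ioo (0 : ℝ) 1, t ^ (a - 1) * (1 - t) ^ (b - 1) = ProbabilityTheory.beta a b := by
  rw [ProbabilityTheory.beta_eq_betaIntegralReal a b ha hb, Complex.betaIntegral,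
    intervalIntegral.integral_of_le zero_le_one, ← MeasureTheory.integral_Ioc_eq_integral_Ioo,
    ← RCLike.re_to_complex, ← integral_re]
  · refine MeasureTheory.setIntegral_congr_fun measurableSet_Ioc fun x hx => ?_
    norm_cast
    rw [← Complex.ofReal_cpow hx.1.le, ← Complex.ofReal_cpow (by linarith [hx.2]),
      RCLike.re_to_complex, Complex.re_mul_ofReal, Complex.ofReal_re]
  · have h := Complex.betaIntegral_convergent (u := a) (v := b) (by simpa) (by simpa)
    rwa [intervalIntegrable_iff_integrableOn_Ioc_of_le zero_le_one] at h

/-- The even moments of `(1 - x²) ^ s`, by the substitution `t = x²` on `(0, 1)`. -/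
theorem integral_even_pow_mul_weight {s : ℝ} (hs : -1 < s) (i : ℕ) :
    ∫ x in (-1 : ℝ)..1, x ^ (2 * i) * (1 - x ^ 2) ^ s
      = ProbabilityTheory.beta (i + 1 / 2) (s + 1) := by
  have hint := (intervalIntegrable_eval_mul hs (X ^ (2 * i)))
  simp only [eval_pow, eval_X] at hint
  have h0 : (0 : ℝ) ∈ Set.uIcc (-1 : ℝ) 1 := by simp
  have i1 := hint.mono_set (Set.uIcc_subset_uIcc_left h0)
  have i2 := hint.mono_set (Set.uIcc_subset_uIcc_right h0)
  have hneg : ∫ x in (-1 : ℝ)..0, x ^ (2 * i) * (1 - x ^ 2) ^ s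
      = ∫ x in (0 : ℝ)..1, x ^ (2 * i) * (1 - x ^ 2) ^ s := by
    have := intervalIntegral.integral_comp_neg
      (fun x : ℝ => x ^ (2 * i) * (1 - x ^ 2) ^ s) (a := 0) (b := 1)
    simp only [pow_mul, neg_sq, neg_zero] at this ⊢
    exact this.symm
  rw [← intervalIntegral.integral_add_adjacent_intervals i1 i2, hneg]
  -- On the open interval all bases are positive, so that the exponent laws of `Real.rpow` apply.
  have himage : (fun x : ℝ => x ^ 2) '' Set.Ioo 0 1 = Set.Ioo 0 1 := by
    ext t
    constructor
    · rintro ⟨x, hx, rfl⟩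
      exact ⟨by have := hx.1; positivity, by nlinarith [hx.1, hx.2]⟩
    · intro ht
      refine ⟨√t, ⟨Real.sqrt_pos.2 ht.1, ?_⟩, Real.sq_sqrt ht.1.le⟩
      rw [Real.sqrt_lt' one_pos]
      simpa using ht.2
  have hsub := MeasureTheory.integral_image_eq_integral_abs_deriv_smul
    (s := Set.Ioo (0 : ℝ) 1) (f := fun x : ℝ => x ^ 2) (f' := fun x => 2 * x) measurableSet_Ioo
    (fun x _ => by simpa using (hasDerivAt_pow 2 x).hasDerivWithinAt)
    (fun x hx y hy hxy => (pow_left_inj₀ hx.1.le hy.1.le two_ne_zero).1 hxy)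
    (fun t => t ^ ((i + 1 / 2 : ℝ) - 1) * (1 - t) ^ (s + 1 - 1))
  rw [himage, setIntegral_beta (by positivity) (by linarith)] at hsub
  rw [hsub, intervalIntegral.integral_of_le zero_le_one, MeasureTheory.integral_Ioc_eq_integral_Ioo,
    ← two_mul, ← MeasureTheory.integral_const_mul]
  refine MeasureTheory.setIntegral_congr_fun measurableSet_Ioo fun x hx => ?_
  have hx0 : 0 < x := hx.1
  have e1 : (x ^ 2) ^ ((i + 1 / 2 : ℝ) - 1) * x = x ^ (2 * i) := by
    rw [← Real.rpow_natCast x 2, ← Real.rpow_mul hx0.le]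
    nth_rewrite 2 [← Real.rpow_one x]
    rw [← Real.rpow_add hx0, ← Real.rpow_natCast]
    congr 1
    push_cast
    ring
  simp only [smul_eq_mul, add_sub_cancel_right]
  rw [abs_of_pos (by positivity), ← e1]
  ring

theorem integral_even_pow_mul_pow_mul_weight {s : ℝ} (hs : -1 < s) (i j : ℕ) :
    ∫ x in (-1 : ℝ)..1, x ^ (2 * i) * (1 - x ^ 2) ^ j * (1 - x ^ 2) ^ s
      = ProbabilityTheory.beta (i + 1 / 2) (s + j + 1) := by
  have hj : (0 : ℝ) ≤ j := j.cast_nonneg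
  rw [← integral_even_pow_mul_weight (s := s + j) (by linarith),
    intervalIntegral.integral_of_le (by norm_num), intervalIntegral.integral_of_le (by norm_num),
    MeasureTheory.integral_Ioc_eq_integral_Ioo, MeasureTheory.integral_Ioc_eq_integral_Ioo]
  refine MeasureTheory.setIntegral_congr_fun measurableSet_Ioo fun x hx => ?_
  have hx0 : 0 < 1 - x ^ 2 := by nlinarith [hx.1, hx.2]
  rw [Real.rpow_add_natCast hx0.ne']
  ring

/-! ### The functional of the weight `x ^ (2 l) w(x)` -/

/-- Integration of polynomials over `(-1, 1)` against `x ^ (2 l) w(x)`, where `w` is the normalized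
Gegenbauer weight. The condition `-1 / 2 < lam` makes the weight integrable, whence linearity. -/
noncomputable def gegenbauerFunctional {lam : ℝ} (hlam : -1 / 2 < lam) (l : ℕ) :
    ℝ[X] →ₗ[ℝ] ℝ where
  toFun p := ∫ x in (-1 : ℝ)..1, p.eval x * (x ^ (2 * l) * gegenbauerWeight lam x)
  map_add' p q := by
    have hint (p : ℝ[X]) : IntervalIntegrable
        (fun x : ℝ => p.eval x * (x ^ (2 * l) * gegenbauerWeight lam x))
        MeasureTheory.volume (-1) 1 := by
      refine (intervalIntegrable_eval_mul (s := lam - 1 / 2) (by linarith)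
        (C (ProbabilityTheory.beta (1 / 2) (lam + 1 / 2))⁻¹ * (p * X ^ (2 * l)))).congr
        fun x _ => ?_
      simp only [gegenbauerWeight, eval_mul, eval_C, eval_pow, eval_X]
      ring
    rw [← intervalIntegral.integral_add (hint p) (hint q)]
    simp only [eval_add, add_mul]
  map_smul' a p := by
    simp only [eval_smul, smul_eq_mul, RingHom.id_apply, mul_assoc]
    exact intervalIntegral.integral_const_mul _ _

section

variable {lam : ℝ} (hlam : -1 / 2 < lam) (l : ℕ)

theorem gegenbauerFunctional_apply (p : ℝ[X]) : gegenbauerFunctional hlam l p =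
    ∫ x in (-1 : ℝ)..1, p.eval x * (x ^ (2 * l) * gegenbauerWeight lam x) := rfl

theorem isOrthonormalPolynomials_iff (φ : ℕ → ℝ[X]) :
    IsOrthonormalPolynomials (fun x => x ^ (2 * l) * gegenbauerWeight lam x) φ ↔
      IsOrthonormalFor (gegenbauerFunctional hlam l) φ := by
  have key (m n : ℕ) : gegenbauerFunctional hlam l (φ m * φ n) =
      ∫ x in (-1 : ℝ)..1,
        (φ m).eval x * (φ n).eval x * (x ^ (2 * l) * gegenbauerWeight lam x) := by
    simp only [gegenbauerFunctional_apply, eval_mul]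
  exact ⟨fun h => ⟨h.1, h.2, fun m n => (key m n).trans (h.3 m n)⟩,
    fun h => ⟨h.1, h.2, fun m n => (key m n).symm.trans (h.3 m n)⟩⟩

/-- A factor `X ^ 2` can be moved into the weight; this reduces odd degrees to even ones. -/
theorem gegenbauerFunctional_X_sq_mul (p : ℝ[X]) :
    gegenbauerFunctional hlam l (X ^ 2 * p) = gegenbauerFunctional hlam (l + 1) p := by
  simp only [gegenbauerFunctional_apply, eval_mul, eval_pow, eval_X]
  congr 1
  ext x
  ring

theorem gegenbauerFunctional_eq_zero_of_odd (p : ℝ[X]) (hp : ∀ x, p.eval (-x) = -p.eval x) :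
    gegenbauerFunctional hlam l p = 0 := by
  have h := intervalIntegral.integral_comp_neg
    (fun x : ℝ => p.eval x * (x ^ (2 * l) * gegenbauerWeight lam x)) (a := -1) (b := 1)
  simp only [hp, neg_neg, gegenbauerWeight, pow_mul, neg_sq, neg_mul,
    intervalIntegral.integral_neg] at h
  simp only [gegenbauerFunctional_apply, gegenbauerWeight, pow_mul]
  linarith

theorem gegenbauerFunctional_even_pow_mul (i j : ℕ) :
    gegenbauerFunctional hlam l (X ^ (2 * i) * (X ^ 2 - 1) ^ j) =
      (-1) ^ j * ((ProbabilityTheory.beta (1 / 2) (lam + 1 / 2))⁻¹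
        * ProbabilityTheory.beta (l + i + 1 / 2) (lam + j + 1 / 2)) := by
  have h := integral_even_pow_mul_pow_mul_weight (s := lam - 1 / 2) (by linarith) (l + i) j
  have e : lam - 1 / 2 + j + 1 = lam + j + 1 / 2 := by ring
  rw [e, Nat.cast_add] at h
  rw [← h, ← mul_assoc, ← intervalIntegral.integral_const_mul, gegenbauerFunctional_apply]
  congr 1
  ext x
  have e2 : (x ^ 2 - 1) ^ j = (-1) ^ j * (1 - x ^ 2) ^ j := by rw [← mul_pow]; ring
  simp only [eval_mul, eval_pow, eval_X, eval_sub, eval_one, gegenbauerWeight, e2]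
  ring

/-- The substitution `x ↦ 2 x² - 1` turns `(x - 1) / 2` into `x² - 1` and `(x + 1) / 2` into `x²`. -/
theorem jacobi_comp (α β : ℝ) (n : ℕ) : (jacobi α β n).comp (2 * X ^ 2 - 1) =
    ∑ i ∈ Finset.range (n + 1),
      C (poch (α + n - i + 1) i / (i.factorial : ℝ)
        * (poch (β + i + 1) (n - i) / ((n - i).factorial : ℝ)))
      * (X ^ (2 * i) * (X ^ 2 - 1) ^ (n - i)) := by
  have hC : C (1 / 2 : ℝ) * 2 = 1 := by
    rw [show (2 : ℝ[X]) = C 2 from rfl, ← C_mul]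
    norm_num
  have h1 : C (1 / 2 : ℝ) * (2 * X ^ 2 - 1 - 1) = X ^ 2 - 1 := by linear_combination (X ^ 2 - 1) * hC
  have h2 : C (1 / 2 : ℝ) * (2 * X ^ 2 - 1 + 1) = X ^ 2 := by linear_combination (X ^ 2) * hC
  rw [jacobi, Polynomial.sum_comp]
  refine Finset.sum_congr rfl fun i _ => ?_
  simp only [mul_comp, pow_comp, sub_comp, add_comp, C_comp, X_comp, one_comp]
  rw [h1, h2, pow_mul]
  ring

/-- Pairing of `P_n^{(lam - 1/2, l - 1/2)}(2 x² - 1)` with the even powers up to `x ^ (2 n)`: the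
value is a constant times the `n`-th forward difference of `(x)_k`, which vanishes for `k < n`. -/
theorem gegenbauerFunctional_even_pow_mul_jacobi (n k : ℕ) (hk : k ≤ n) :
    gegenbauerFunctional hlam l
        (X ^ (2 * k) * (jacobi (lam - 1 / 2) (l - 1 / 2) n).comp (2 * X ^ 2 - 1)) =
      if k = n then (ProbabilityTheory.beta (1 / 2) (lam + 1 / 2))⁻¹ *
        (Real.Gamma (lam + n + 1 / 2) * Real.Gamma (l + n + 1 / 2)
          / Real.Gamma (lam + l + 2 * n + 1)) else 0 := by
  have key : gegenbauerFunctional hlam l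
        (X ^ (2 * k) * (jacobi (lam - 1 / 2) (l - 1 / 2) n).comp (2 * X ^ 2 - 1)) =
      (ProbabilityTheory.beta (1 / 2) (lam + 1 / 2))⁻¹ *
        (Real.Gamma (lam + n + 1 / 2) * Real.Gamma (l + n + 1 / 2)
          / Real.Gamma (lam + l + k + n + 1)) / (n.factorial : ℝ)
        * ∑ i ∈ Finset.range (n + 1),
          (-1 : ℝ) ^ (n - i) * n.choose i * poch (l + 1 / 2 + i) k := by
    rw [jacobi_comp, Finset.mul_sum, map_sum, Finset.mul_sum]
    refine Finset.sum_congr rfl fun i hi => ?_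
    have hi' : i ≤ n := Nat.lt_succ_iff.mp (Finset.mem_range.mp hi)
    obtain ⟨j, rfl⟩ := Nat.exists_eq_add_of_le hi'
    have hsub : i + j - i = j := by omega
    rw [mul_left_comm, linearMap_apply_C_mul, ← mul_assoc (X ^ (2 * k)), ← pow_add,
      ← mul_add, gegenbauerFunctional_even_pow_mul, hsub]
    have hj : (0 : ℝ) ≤ j := j.cast_nonneg
    -- The Pochhammer factors of the coefficient of index `i` complete the Gamma factors of its moment
    -- to `Γ(lam + n + 1/2)` and `Γ(l + n + 1/2)`, leaving only `(l + 1/2 + i)_k` to depend on `i`.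
    have g1 := gamma_add_nat (x := lam + j + 1 / 2) (by linarith) i
    have g2 := gamma_add_nat (x := (l : ℝ) + 1 / 2 + i) (by positivity) j
    have g3 := gamma_add_nat (x := (l : ℝ) + 1 / 2 + i) (by positivity) k
    have hc : (((i + j).choose i : ℕ) : ℝ)
        = ((i + j).factorial : ℝ) / (i.factorial * j.factorial) := by
      rw [Nat.cast_choose ℝ (Nat.le_add_right i j), hsub]
    have r1 : lam - 1 / 2 + ((i + j : ℕ) : ℝ) - i + 1 = lam + j + 1 / 2 := by push_cast; ring
    have r2 : (l : ℝ) - 1 / 2 + i + 1 = l + 1 / 2 + i := by ring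
    have r3 : lam + ((i + j : ℕ) : ℝ) + 1 / 2 = lam + j + 1 / 2 + i := by push_cast; ring
    have r4 : (l : ℝ) + ((i + j : ℕ) : ℝ) + 1 / 2 = l + 1 / 2 + i + j := by push_cast; ring
    have r5 : (l : ℝ) + ((k + i : ℕ) : ℝ) + 1 / 2 = l + 1 / 2 + i + k := by push_cast; ring
    have r6 : lam + l + k + ((i + j : ℕ) : ℝ) + 1
        = l + 1 / 2 + i + k + (lam + j + 1 / 2) := by push_cast; ring
    rw [r1, r2, r3, r4, r5, r6, ProbabilityTheory.beta.eq_def (l + 1 / 2 + i + k), g1, g2, g3, hc]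
    have f1 : ((i + j).factorial : ℝ) ≠ 0 := by positivity
    field_simp
  rw [key, sum_neg_one_pow_mul_choose_mul_poch _ _ _ hk]
  split_ifs with hkn
  · subst hkn
    rw [div_mul_cancel₀ _ (by positivity)]
    congr 4
    ring
  · rw [mul_zero]

end

/-! ### Degrees and leading coefficients -/

theorem jacobi_coeff_pos {α β : ℝ} (h : 0 < α + β + 1) (n : ℕ) : 0 < (jacobi α β n).coeff n := by
  have hn : (0 : ℝ) ≤ n := n.cast_nonneg
  have := poch_pos (x := α + β + n + 1) (by linarith) n
  rw [jacobi_coeff]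
  positivity

theorem natDegree_jacobi {α β : ℝ} (h : 0 < α + β + 1) (n : ℕ) : (jacobi α β n).natDegree = n :=
  natDegree_eq_of_le_of_coeff_ne_zero (jacobi_natDegree_le α β n) (jacobi_coeff_pos h n).ne'

theorem natDegree_jacobi_comp {α β : ℝ} (h : 0 < α + β + 1) (n : ℕ) :
    ((jacobi α β n).comp (2 * X ^ 2 - 1)).natDegree = 2 * n := by
  have h2 : (2 * X ^ 2 - 1 : ℝ[X]).natDegree = 2 := by compute_degree!
  rw [natDegree_comp, natDegree_jacobi h, h2, mul_comm]

theorem leadingCoeff_jacobi_comp {α β : ℝ} (h : 0 < α + β + 1) (n : ℕ) :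
    ((jacobi α β n).comp (2 * X ^ 2 - 1)).leadingCoeff
      = poch (α + β + n + 1) n / (n.factorial : ℝ) := by
  have h2 : (2 * X ^ 2 - 1 : ℝ[X]).natDegree = 2 := by compute_degree!
  have h3 : (2 * X ^ 2 - 1 : ℝ[X]).leadingCoeff = 2 := by
    rw [leadingCoeff, h2]
    simp [coeff_one, coeff_ofNat_mul]
  rw [leadingCoeff_comp (by omega), h3, leadingCoeff, natDegree_jacobi h, jacobi_coeff]
  field_simp

theorem modifiedGegenbauer_even (lam : ℝ) (l n : ℕ) : modifiedGegenbauer lam l (2 * n) =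
    C (poch (lam + l) n / poch (l + 1 / 2) n)
      * (jacobi (lam - 1 / 2) (l - 1 / 2) n).comp (2 * X ^ 2 - 1) := by
  rw [modifiedGegenbauer, if_pos (even_two_mul n), Nat.mul_div_cancel_left n two_pos]

/-- The second Jacobi parameter `l + 1/2` is written as `(l + 1) - 1/2`, the parameter of the even
case for `l + 1`. -/
theorem modifiedGegenbauer_odd (lam : ℝ) (l n : ℕ) : modifiedGegenbauer lam l (2 * n + 1) =
    C (poch (lam + l) (n + 1) / poch (l + 1 / 2) (n + 1))
      * X * (jacobi (lam - 1 / 2) ((l + 1 : ℕ) - 1 / 2) n).comp (2 * X ^ 2 - 1) := by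
  have h : (2 * n + 1) / 2 = n := by omega
  have e : ((l + 1 : ℕ) : ℝ) - 1 / 2 = l + 1 / 2 := by push_cast; ring
  rw [modifiedGegenbauer, if_neg (by simp), h, e]

theorem modifiedGegenbauer_even_eval_zero (lam : ℝ) (l n : ℕ) :
    (modifiedGegenbauer lam l (2 * n)).eval 0
      = (-1) ^ n * (poch (lam + l) n / (n.factorial : ℝ)) := by
  have h : (poch (l + 1 / 2) n : ℝ) ≠ 0 := (poch_pos (by positivity) n).ne'
  have e : (l : ℝ) - 1 / 2 + 1 = l + 1 / 2 := by ring
  have e2 : eval 0 (2 * X ^ 2 - 1 : ℝ[X]) = -1 := by simp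
  rw [modifiedGegenbauer_even, eval_mul, eval_C, eval_comp, e2, jacobi_eval_neg_one, e]
  generalize (poch (l + 1 / 2) n : ℝ) = q at h ⊢
  field_simp

section degree

variable {lam : ℝ} {l : ℕ} (hl : 0 < lam + l)
include hl

theorem natDegree_modifiedGegenbauer (m : ℕ) : (modifiedGegenbauer lam l m).natDegree = m := by
  obtain ⟨n, rfl | rfl⟩ := Nat.even_or_odd' m
  · have hc : poch (lam + l) n / poch (l + 1 / 2) n ≠ 0 :=
      (div_pos (poch_pos hl n) (poch_pos (by positivity) n)).ne'
    rw [modifiedGegenbauer_even, natDegree_C_mul hc, natDegree_jacobi_comp (by linarith)]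
  · have hc : poch (lam + l) (n + 1) / poch (l + 1 / 2) (n + 1) ≠ 0 :=
      (div_pos (poch_pos hl _) (poch_pos (by positivity) _)).ne'
    have hd : 0 < lam - 1 / 2 + (((l + 1 : ℕ) : ℝ) - 1 / 2) + 1 := by push_cast; linarith
    have h0 : (jacobi (lam - 1 / 2) ((l + 1 : ℕ) - 1 / 2) n).comp (2 * X ^ 2 - 1) ≠ 0 := by
      rw [← leadingCoeff_ne_zero, leadingCoeff_jacobi_comp hd]
      have hn : (0 : ℝ) ≤ n := n.cast_nonneg
      exact (div_pos (poch_pos (by linarith) n) (by positivity)).ne'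
    rw [modifiedGegenbauer_odd, mul_assoc, natDegree_C_mul hc, natDegree_X_mul h0,
      natDegree_jacobi_comp hd]

theorem leadingCoeff_modifiedGegenbauer_even (n : ℕ) :
    (modifiedGegenbauer lam l (2 * n)).leadingCoeff
      = poch (lam + l) (2 * n) / (poch (l + 1 / 2) n * (n.factorial : ℝ)) := by
  have e : lam - 1 / 2 + ((l : ℝ) - 1 / 2) + n + 1 = lam + l + n := by ring
  rw [modifiedGegenbauer_even, leadingCoeff_mul, leadingCoeff_C,
    leadingCoeff_jacobi_comp (by linarith), e, two_mul, poch_add]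
  ring

theorem leadingCoeff_modifiedGegenbauer_odd (n : ℕ) :
    (modifiedGegenbauer lam l (2 * n + 1)).leadingCoeff
      = poch (lam + l) (2 * n + 1) / (poch (l + 1 / 2) (n + 1) * (n.factorial : ℝ)) := by
  have e : lam - 1 / 2 + (((l + 1 : ℕ) : ℝ) - 1 / 2) + n + 1 = lam + l + (n + 1 : ℕ) := by
    push_cast; ring
  rw [modifiedGegenbauer_odd, leadingCoeff_mul, leadingCoeff_mul, leadingCoeff_C, leadingCoeff_X,
    leadingCoeff_jacobi_comp (by push_cast; linarith), e,
    show 2 * n + 1 = (n + 1) + n by omega, poch_add (lam + l) (n + 1)]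
  ring

theorem leadingCoeff_modifiedGegenbauer_pos (m : ℕ) :
    0 < (modifiedGegenbauer lam l m).leadingCoeff := by
  have h2 : (0 : ℝ) < l + 1 / 2 := by positivity
  obtain ⟨n, rfl | rfl⟩ := Nat.even_or_odd' m
  · rw [leadingCoeff_modifiedGegenbauer_even hl]
    exact div_pos (poch_pos hl _) (mul_pos (poch_pos h2 _) (by positivity))
  · rw [leadingCoeff_modifiedGegenbauer_odd hl]
    exact div_pos (poch_pos hl _) (mul_pos (poch_pos h2 _) (by positivity))

end degree

/-! ### Orthogonality and norms of the modified Gegenbauer polynomials -/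

section orthogonality

variable {lam : ℝ} (hlam : -1 / 2 < lam) (l : ℕ)

theorem gegenbauerFunctional_even_mul_pow (n : ℕ) :
    gegenbauerFunctional hlam l (modifiedGegenbauer lam l (2 * n) * X ^ (2 * n)) =
      poch (lam + l) n / poch (l + 1 / 2) n *
        ((ProbabilityTheory.beta (1 / 2) (lam + 1 / 2))⁻¹ *
          (Real.Gamma (lam + n + 1 / 2) * Real.Gamma (l + n + 1 / 2)
            / Real.Gamma (lam + l + 2 * n + 1))) := by
  rw [modifiedGegenbauer_even, mul_assoc, linearMap_apply_C_mul, mul_comm (comp _ _),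
    gegenbauerFunctional_even_pow_mul_jacobi hlam l n n le_rfl, if_pos rfl]

theorem modifiedGegenbauer_odd_mul_pow (lam : ℝ) (l n k : ℕ) :
    modifiedGegenbauer lam l (2 * n + 1) * X ^ (2 * k + 1) =
      C (poch (lam + l) (n + 1) / poch (l + 1 / 2) (n + 1)) * (X ^ 2 * (X ^ (2 * k) *
        (jacobi (lam - 1 / 2) ((l + 1 : ℕ) - 1 / 2) n).comp (2 * X ^ 2 - 1))) := by
  rw [modifiedGegenbauer_odd]
  ring

theorem gegenbauerFunctional_odd_mul_pow (n : ℕ) :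
    gegenbauerFunctional hlam l (modifiedGegenbauer lam l (2 * n + 1) * X ^ (2 * n + 1)) =
      poch (lam + l) (n + 1) / poch (l + 1 / 2) (n + 1) *
        ((ProbabilityTheory.beta (1 / 2) (lam + 1 / 2))⁻¹ *
          (Real.Gamma (lam + n + 1 / 2) * Real.Gamma ((l + 1 : ℕ) + n + 1 / 2)
            / Real.Gamma (lam + (l + 1 : ℕ) + 2 * n + 1))) := by
  rw [modifiedGegenbauer_odd_mul_pow, linearMap_apply_C_mul, gegenbauerFunctional_X_sq_mul,
    gegenbauerFunctional_even_pow_mul_jacobi hlam (l + 1) n n le_rfl, if_pos rfl]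

theorem modifiedGegenbauer_eval_neg (lam : ℝ) (l m : ℕ) (x : ℝ) :
    (modifiedGegenbauer lam l m).eval (-x) = (-1) ^ m * (modifiedGegenbauer lam l m).eval x := by
  obtain ⟨n, rfl | rfl⟩ := Nat.even_or_odd' m
  · rw [modifiedGegenbauer_even]
    simp [eval_comp, pow_mul]
  · rw [modifiedGegenbauer_odd]
    simp [eval_comp, pow_add, pow_mul]

/-- `C_m` is orthogonal to `x ^ k` for `k < m`: by parity if `m + k` is odd, and by the vanishing of
a forward difference otherwise. -/
theorem gegenbauerFunctional_mul_pow_eq_zero {m k : ℕ} (hk : k < m) :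
    gegenbauerFunctional hlam l (modifiedGegenbauer lam l m * X ^ k) = 0 := by
  by_cases hpar : Odd (m + k)
  · refine gegenbauerFunctional_eq_zero_of_odd hlam l _ fun x => ?_
    rw [eval_mul, eval_mul, modifiedGegenbauer_eval_neg, eval_pow, eval_pow, eval_X, eval_X,
      neg_pow x, mul_mul_mul_comm, ← pow_add, hpar.neg_one_pow, neg_one_mul]
  · rw [Nat.not_odd_iff_even] at hpar
    obtain ⟨n, rfl | rfl⟩ := Nat.even_or_odd' m
    · obtain ⟨j, rfl⟩ : ∃ j, k = 2 * j := ⟨k / 2, by grind⟩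
      rw [modifiedGegenbauer_even, mul_assoc, linearMap_apply_C_mul, mul_comm (comp _ _),
        gegenbauerFunctional_even_pow_mul_jacobi hlam l n j (by omega), if_neg (by omega),
        mul_zero]
    · obtain ⟨j, rfl⟩ : ∃ j, k = 2 * j + 1 := ⟨k / 2, by grind⟩
      rw [modifiedGegenbauer_odd_mul_pow, linearMap_apply_C_mul,
        gegenbauerFunctional_X_sq_mul,
        gegenbauerFunctional_even_pow_mul_jacobi hlam (l + 1) n j (by omega), if_neg (by omega),
        mul_zero]

/-- Pairing a polynomial of degree at most `m` with `C_m` sees only its coefficient of `x ^ m`. -/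
theorem gegenbauerFunctional_modifiedGegenbauer_mul {m : ℕ} {q : ℝ[X]} (hq : q.natDegree ≤ m) :
    gegenbauerFunctional hlam l (modifiedGegenbauer lam l m * q) =
      q.coeff m * gegenbauerFunctional hlam l (modifiedGegenbauer lam l m * X ^ m) := by
  conv_lhs => rw [q.as_sum_range_C_mul_X_pow' (Nat.lt_succ_of_le hq)]
  rw [Finset.mul_sum, map_sum, Finset.sum_range_succ, Finset.sum_eq_zero fun k hk => ?_, zero_add,
    mul_left_comm, linearMap_apply_C_mul]
  rw [mul_left_comm, linearMap_apply_C_mul,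
    gegenbauerFunctional_mul_pow_eq_zero hlam l (Finset.mem_range.mp hk), mul_zero]

/-- The norm and the functional are normalized by different beta functions, whose quotient is
`(lam + 1)_l / (1/2)_l` by `beta_half_div_beta_add`. -/
theorem modifiedGegenbauerNorm_eq (m : ℕ) : modifiedGegenbauerNorm lam l m =
    ProbabilityTheory.beta (1 / 2) (lam + 1 / 2) / ProbabilityTheory.beta (l + 1 / 2) (lam + 1 / 2)
      * gegenbauerFunctional hlam l (modifiedGegenbauer lam l m * modifiedGegenbauer lam l m) := by
  have hb := (ProbabilityTheory.beta_pos (α := 1 / 2) (β := lam + 1 / 2) (by norm_num)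
    (by linarith)).ne'
  rw [modifiedGegenbauerNorm, gegenbauerFunctional_apply, div_mul_eq_mul_div,
    div_eq_inv_mul (_ * _)]
  congr 1
  rw [← intervalIntegral.integral_const_mul]
  refine intervalIntegral.integral_congr fun x _ => ?_
  simp only [gegenbauerWeight, eval_mul]
  generalize ProbabilityTheory.beta (1 / 2) (lam + 1 / 2) = b at hb ⊢
  field_simp

theorem beta_half_div_beta_add (hlam : -1 / 2 < lam) :
    ProbabilityTheory.beta (1 / 2) (lam + 1 / 2) / ProbabilityTheory.beta (l + 1 / 2) (lam + 1 / 2)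
      = poch (lam + 1) l / poch (1 / 2) l := by
  have h1 := gamma_add_nat (x := 1 / 2) (by norm_num) l
  have h2 := gamma_add_nat (x := lam + 1) (by linarith) l
  have e1 : (1 : ℝ) / 2 + (lam + 1 / 2) = lam + 1 := by ring
  have e2 : (l : ℝ) + 1 / 2 + (lam + 1 / 2) = lam + 1 + l := by ring
  have p1 := (Real.Gamma_pos_of_pos (s := 1 / 2) (by norm_num)).ne'
  have p2 := (Real.Gamma_pos_of_pos (s := lam + 1 / 2) (by linarith)).ne'
  have p3 := (Real.Gamma_pos_of_pos (s := lam + 1) (by linarith)).ne'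
  have p4 := (poch_pos (x := 1 / 2) (by norm_num) l).ne'
  have p5 := (poch_pos (x := lam + 1) (by linarith) l).ne'
  rw [ProbabilityTheory.beta, ProbabilityTheory.beta, e1, e2, add_comm (l : ℝ), h1, h2]
  generalize Real.Gamma (lam + 1 / 2) = g at p2 ⊢
  field_simp

variable {l} (hl : 0 < lam + l)
include hlam hl

theorem modifiedGegenbauerNorm_eq_leadingCoeff_mul (m : ℕ) : modifiedGegenbauerNorm lam l m =
    ProbabilityTheory.beta (1 / 2) (lam + 1 / 2) / ProbabilityTheory.beta (l + 1 / 2) (lam + 1 / 2)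
      * ((modifiedGegenbauer lam l m).leadingCoeff *
        gegenbauerFunctional hlam l (modifiedGegenbauer lam l m * X ^ m)) := by
  have hd := natDegree_modifiedGegenbauer hl m
  rw [modifiedGegenbauerNorm_eq hlam, gegenbauerFunctional_modifiedGegenbauer_mul hlam l hd.le,
    leadingCoeff, hd]

theorem modifiedGegenbauerNorm_even (n : ℕ) : modifiedGegenbauerNorm lam l (2 * n) =
    poch (lam + 1 / 2) n * poch (lam + l) n * (lam + l)
      / ((n.factorial : ℝ) * poch (l + 1 / 2) n * (lam + l + 2 * n)) := by
  have hb := (ProbabilityTheory.beta_pos (α := 1 / 2) (β := lam + 1 / 2) (by norm_num)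
    (by linarith)).ne'
  have hn : (0 : ℝ) ≤ n := n.cast_nonneg
  have g1 := gamma_add_nat (x := lam + 1 / 2) (by linarith) n
  have g2 := gamma_add_nat (x := (l : ℝ) + 1 / 2) (by positivity) n
  have g3 := gamma_add_nat (x := lam + l + 1) (by linarith) (2 * n)
  have e1 : lam + n + 1 / 2 = lam + 1 / 2 + n := by ring
  have e2 : (l : ℝ) + n + 1 / 2 = l + 1 / 2 + n := by ring
  have e3 : lam + l + 2 * n + 1 = lam + l + 1 + (2 * n : ℕ) := by push_cast; ring
  have e4 : (l : ℝ) + 1 / 2 + (lam + 1 / 2) = lam + l + 1 := by ring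
  -- Both sides are `(lam + l)_{2n + 1}`, split off at the last and at the first factor.
  have hp := (poch_succ (lam + l) (2 * n)).symm.trans (poch_succ_left (lam + l) (2 * n))
  push_cast at hp
  have p1 := (Real.Gamma_pos_of_pos (s := (l : ℝ) + 1 / 2) (by positivity)).ne'
  have p2 := (Real.Gamma_pos_of_pos (s := lam + 1 / 2) (by linarith)).ne'
  have p3 := (Real.Gamma_pos_of_pos (s := lam + l + 1) (by linarith)).ne'
  have p4 := (poch_pos (x := (l : ℝ) + 1 / 2) (by positivity) n).ne'
  have p5 := (poch_pos (x := lam + l + 1) (by linarith) (2 * n)).ne'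
  have p6 : lam + l + 2 * n ≠ 0 := by positivity
  rw [modifiedGegenbauerNorm_eq_leadingCoeff_mul hlam hl, gegenbauerFunctional_even_mul_pow,
    leadingCoeff_modifiedGegenbauer_even hl, e1, e2, e3, g1, g2, g3,
    ProbabilityTheory.beta.eq_def (l + 1 / 2), e4]
  -- Fresh names keep `field_simp` from rewriting the arguments of `Γ` and of the beta function.
  generalize lam + 1 / 2 = a at hb p2 ⊢
  generalize (l : ℝ) + 1 / 2 = b at p1 p4 ⊢
  field_simp
  linear_combination poch (lam + l) n * poch a n * hp

theorem modifiedGegenbauerNorm_odd (n : ℕ) : modifiedGegenbauerNorm lam l (2 * n + 1) =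
    poch (lam + 1 / 2) n * poch (lam + l) (n + 1) * (lam + l)
      / ((n.factorial : ℝ) * poch (l + 1 / 2) (n + 1) * (lam + l + 2 * n + 1)) := by
  have hb := (ProbabilityTheory.beta_pos (α := 1 / 2) (β := lam + 1 / 2) (by norm_num)
    (by linarith)).ne'
  have hn : (0 : ℝ) ≤ n := n.cast_nonneg
  have g1 := gamma_add_nat (x := lam + 1 / 2) (by linarith) n
  have g2 := gamma_add_nat (x := (l : ℝ) + 1 / 2) (by positivity) (n + 1)
  have g3 := gamma_add_nat (x := lam + l + 1) (by linarith) (2 * n + 1)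
  have e1 : lam + n + 1 / 2 = lam + 1 / 2 + n := by ring
  have e2 : ((l + 1 : ℕ) : ℝ) + n + 1 / 2 = l + 1 / 2 + (n + 1 : ℕ) := by push_cast; ring
  have e3 : lam + (l + 1 : ℕ) + 2 * n + 1 = lam + l + 1 + (2 * n + 1 : ℕ) := by push_cast; ring
  have e4 : (l : ℝ) + 1 / 2 + (lam + 1 / 2) = lam + l + 1 := by ring
  -- Both sides are `(lam + l)_{2n + 2}`, split off at the last and at the first factor.
  have hp := (poch_succ (lam + l) (2 * n + 1)).symm.trans (poch_succ_left (lam + l) (2 * n + 1))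
  push_cast at hp
  have p1 := (Real.Gamma_pos_of_pos (s := (l : ℝ) + 1 / 2) (by positivity)).ne'
  have p2 := (Real.Gamma_pos_of_pos (s := lam + 1 / 2) (by linarith)).ne'
  have p3 := (Real.Gamma_pos_of_pos (s := lam + l + 1) (by linarith)).ne'
  have p4 := (poch_pos (x := (l : ℝ) + 1 / 2) (by positivity) (n + 1)).ne'
  have p5 := (poch_pos (x := lam + l + 1) (by linarith) (2 * n + 1)).ne'
  have p6 : lam + l + 2 * n + 1 ≠ 0 := by positivity
  rw [modifiedGegenbauerNorm_eq_leadingCoeff_mul hlam hl, gegenbauerFunctional_odd_mul_pow,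
    leadingCoeff_modifiedGegenbauer_odd hl, e1, e2, e3, g1, g2, g3,
    ProbabilityTheory.beta.eq_def (l + 1 / 2), e4]
  -- Fresh names keep `field_simp` from rewriting the arguments of `Γ` and of the beta function.
  generalize lam + 1 / 2 = a at hb p2 ⊢
  generalize (l : ℝ) + 1 / 2 = b at p1 p4 ⊢
  field_simp
  linear_combination poch (lam + l) (n + 1) * poch a n * hp

theorem modifiedGegenbauerNorm_pos (m : ℕ) : 0 < modifiedGegenbauerNorm lam l m := by
  have h1 : 0 < lam + 1 / 2 := by linarith
  have h2 : (0 : ℝ) < l + 1 / 2 := by positivity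
  obtain ⟨n, rfl | rfl⟩ := Nat.even_or_odd' m
  · rw [modifiedGegenbauerNorm_even hlam hl]
    have := poch_pos h1 n
    have := poch_pos h2 n
    have := poch_pos hl n
    positivity
  · rw [modifiedGegenbauerNorm_odd hlam hl]
    have := poch_pos h1 n
    have := poch_pos h2 (n + 1)
    have := poch_pos hl (n + 1)
    positivity

end orthogonality

/-! ### The orthonormal family -/

/-- The modified Gegenbauer polynomial `C_m^{(lam, l)}`, scaled to norm `1` for the weight
`x ^ (2 l) w(x)`. -/
noncomputable def normalizedGegenbauer (lam : ℝ) (l m : ℕ) : ℝ[X] :=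
  C √(poch (lam + 1) l / (poch (1 / 2) l * modifiedGegenbauerNorm lam l m))
    * modifiedGegenbauer lam l m

section normalized

variable {lam : ℝ} (hlam : -1 / 2 < lam) {l : ℕ} (hl : 0 < lam + l)
include hlam hl

theorem normalizingFactor_pos (m : ℕ) :
    0 < poch (lam + 1) l / (poch (1 / 2) l * modifiedGegenbauerNorm lam l m) :=
  div_pos (poch_pos (by linarith) l)
    (mul_pos (poch_pos (by norm_num) l) (modifiedGegenbauerNorm_pos hlam hl m))

theorem gegenbauerFunctional_normalizedGegenbauer_mul_self (m : ℕ) :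
    gegenbauerFunctional hlam l (normalizedGegenbauer lam l m * normalizedGegenbauer lam l m)
      = 1 := by
  have hpos := normalizingFactor_pos hlam hl m
  have hN := modifiedGegenbauerNorm_eq hlam l m
  rw [beta_half_div_beta_add l hlam] at hN
  have hN0 := (modifiedGegenbauerNorm_pos hlam hl m).ne'
  have p1 := (poch_pos (x := 1 / 2) (by norm_num) l).ne'
  have p2 := (poch_pos (x := lam + 1) (by linarith) l).ne'
  rw [normalizedGegenbauer, mul_mul_mul_comm, ← C_mul, Real.mul_self_sqrt hpos.le,
    linearMap_apply_C_mul, div_mul_eq_mul_div, div_eq_one_iff_eq (mul_ne_zero p1 hN0), hN]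
  field_simp

theorem natDegree_normalizedGegenbauer (m : ℕ) : (normalizedGegenbauer lam l m).natDegree = m := by
  rw [normalizedGegenbauer, natDegree_C_mul (Real.sqrt_pos.2 (normalizingFactor_pos hlam hl m)).ne',
    natDegree_modifiedGegenbauer hl]

theorem leadingCoeff_normalizedGegenbauer_pos (m : ℕ) :
    0 < (normalizedGegenbauer lam l m).leadingCoeff := by
  rw [normalizedGegenbauer, leadingCoeff_mul, leadingCoeff_C]
  exact mul_pos (Real.sqrt_pos.2 (normalizingFactor_pos hlam hl m))
    (leadingCoeff_modifiedGegenbauer_pos hl m)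

omit hl in
theorem gegenbauerFunctional_normalizedGegenbauer_mul {m : ℕ} {q : ℝ[X]} (hq : q.degree < m) :
    gegenbauerFunctional hlam l (normalizedGegenbauer lam l m * q) = 0 := by
  have h0 : q.coeff m = 0 := coeff_eq_zero_of_degree_lt hq
  have hd : q.natDegree ≤ m := natDegree_le_iff_degree_le.2 hq.le
  rw [normalizedGegenbauer, mul_assoc, linearMap_apply_C_mul,
    gegenbauerFunctional_modifiedGegenbauer_mul hlam l hd, h0, zero_mul, mul_zero]

theorem isOrthonormalFor_normalizedGegenbauer :
    IsOrthonormalFor (gegenbauerFunctional hlam l) (normalizedGegenbauer lam l) where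
  natDegree_eq := natDegree_normalizedGegenbauer hlam hl
  leadingCoeff_pos := leadingCoeff_normalizedGegenbauer_pos hlam hl
  orthonormal m n := by
    have key {m n : ℕ} (h : m < n) : gegenbauerFunctional hlam l
        (normalizedGegenbauer lam l n * normalizedGegenbauer lam l m) = 0 := by
      refine gegenbauerFunctional_normalizedGegenbauer_mul hlam ?_
      refine degree_le_natDegree.trans_lt ?_
      rw [natDegree_normalizedGegenbauer hlam hl]
      exact_mod_cast h
    obtain h | rfl | h := lt_trichotomy m n
    · rw [if_neg h.ne, mul_comm, key h]
    · rw [if_pos rfl, gegenbauerFunctional_normalizedGegenbauer_mul_self hlam hl]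
    · rw [if_neg h.ne', key h]

theorem IsOrthonormalFor.eq_normalizedGegenbauer {φ : ℕ → ℝ[X]}
    (h : IsOrthonormalFor (gegenbauerFunctional hlam l) φ) : φ = normalizedGegenbauer lam l :=
  funext fun m => h.eq_of_orthogonal (natDegree_normalizedGegenbauer hlam hl m)
    (leadingCoeff_normalizedGegenbauer_pos hlam hl m)
    (gegenbauerFunctional_normalizedGegenbauer_mul_self hlam hl m)
    fun _ hq => gegenbauerFunctional_normalizedGegenbauer_mul hlam hq

end normalized

theorem theorem3p4 (lam : ℝ) (hlam : -1 / 2 < lam) (n l : ℕ) (hn : 1 ≤ n) (hl : 1 ≤ l) :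
    -- existence and uniqueness of the orthonormal polynomials for the weight `x^(2l) w(x)`
    (∃! φ : ℕ → ℝ[X],
      IsOrthonormalPolynomials (fun x => x ^ (2 * l) * gegenbauerWeight lam x) φ) ∧
    -- their values at `0` and their leading coefficients
    (∀ φ : ℕ → ℝ[X],
      IsOrthonormalPolynomials (fun x => x ^ (2 * l) * gegenbauerWeight lam x) φ →
        (φ (2 * n)).eval 0 =
            (-1) ^ n
              * √(poch (lam + 1) l / (poch (1 / 2) l * modifiedGegenbauerNorm lam l (2 * n)))
              * ∏ k ∈ Finset.Icc 1 n, (lam + l + k - 1) / k ∧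
        (φ (2 * n)).leadingCoeff =
            poch (lam + l) (2 * n) / (poch (l + 1 / 2) n * (n.factorial : ℝ))
              * √(poch (lam + 1) l / (poch (1 / 2) l * modifiedGegenbauerNorm lam l (2 * n))) ∧
        (φ (2 * n + 1)).leadingCoeff =
            poch (lam + l) (2 * n + 1) / (poch (l + 1 / 2) (n + 1) * (n.factorial : ℝ))
              * √(poch (lam + 1) l
                  / (poch (1 / 2) l * modifiedGegenbauerNorm lam l (2 * n + 1)))) ∧
    -- the norms
    modifiedGegenbauerNorm lam l (2 * n) =
        poch (lam + 1 / 2) n * poch (lam + l) n * (lam + l)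
          / ((n.factorial : ℝ) * poch (l + 1 / 2) n * (lam + l + 2 * n)) ∧
    modifiedGegenbauerNorm lam l (2 * n + 1) =
        poch (lam + 1 / 2) n * poch (lam + l) (n + 1) * (lam + l)
          / ((n.factorial : ℝ) * poch (l + 1 / 2) (n + 1) * (lam + l + 2 * n + 1)) := by
  have hl' : 0 < lam + l := by
    have : (1 : ℝ) ≤ l := by exact_mod_cast hl
    linarith
  have huniq (φ : ℕ → ℝ[X])
      (hφ : IsOrthonormalPolynomials (fun x => x ^ (2 * l) * gegenbauerWeight lam x) φ) :
      φ = normalizedGegenbauer lam l :=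
    ((isOrthonormalPolynomials_iff hlam l φ).1 hφ).eq_normalizedGegenbauer hlam hl'
  refine ⟨⟨normalizedGegenbauer lam l, (isOrthonormalPolynomials_iff hlam l _).2
    (isOrthonormalFor_normalizedGegenbauer hlam hl'), huniq⟩, fun φ hφ => ?_,
    modifiedGegenbauerNorm_even hlam hl' n, modifiedGegenbauerNorm_odd hlam hl' n⟩
  rw [huniq φ hφ, prod_Icc_div_eq_poch]
  simp only [normalizedGegenbauer, eval_mul, eval_C, leadingCoeff_mul, leadingCoeff_C,
    modifiedGegenbauer_even_eval_zero, leadingCoeff_modifiedGegenbauer_even hl',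
    leadingCoeff_modifiedGegenbauer_odd hl']
  exact ⟨by ring, mul_comm _ _, mul_comm _ _⟩
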